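/- Let $k$ be an algebraically closed field and let $\Lambda$ be a finite-dimensional associative unital $k$-algebra which is Gorenstein, i.e. $\mathrm{inj.dim}_{\Lambda}\Lambda<\infty$ and $\mathrm{inj.dim}_{\Lambda^{\mathrm{op}}}\Lambda<\infty$. All modules are finitely generated left modules. For a $\Lambda$-module $M$ let $\Omega_\Lambda(M)$ be the kernel of a projective cover of $M$ and let $\Omega^n_\Lambda$ be its $n$-th iterate, with $\Omega^0_\Lambda(M)=M$. A module $N$ is *periodic of period $p$* if $p$ is the least positive integer with $\Omega^p_\Lambda(N)\cong N$. A *complete resolution* of $M$ is a diagram $T_\bullet\xrightarrow{\theta}P_\bullet\xrightarrow{\varepsilon}M$ where $T_\bullet$ is an acyclic complex, indexed by $\mathbb Z$, of (finitely generated) projective $\Lambda$-modules, $P_\bullet\xrightarrow{\varepsilon}M$ is a projective resolution, and $\theta$ is a chain map with $\theta_i$ an isomorphism for all $i\gg 0$. Put $\Omega_i(T_\bullet)=\operatorname{Cok}(T_{i+1}\to T_i)$. The complete resolution is *periodic* if there is an integer $q>0$ with $\Omega_i(T_\bullet)\cong\Omega_{i+q}(T_\bullet)$ for all $i\in\mathbb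 Z$; the least such $q$ is its *period*. Let $M$ be a $\Lambda$-module, and suppose that for some $n\ge 0$ the syzygy $\Omega^n_\Lambda(M)$ is periodic of period $p$. Then: 1. $M$ admits a periodic complete resolution $T_\bullet\to P_\bullet\to M$ of period $p$, and $P_\bullet\to M$ can be taken to be a minimal projective resolution. 2. The period $p$ is independent of the choice of periodic syzygy: if $\Omega^m_\Lambda(M)$, $m\ge 0$, is also periodic, then its period is $p$ as well; and every periodic complete resolution $T_\bullet\to P_\bullet\to M$ of $M$ in which $P_\bullet\to M$ is a minimal projective resolution has period $p$. -/

import Mathlib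

open CategoryTheory CategoryTheory.Limits

universe w u

namespace GorensteinAlgebra

/-- A ring `Λ` is Gorenstein if it has finite injective dimension both as a left module and as a
right module (that is, as a module over the opposite ring) over itself. -/
def IsGorenstein (Λ : Type u) [Ring Λ] : Prop :=
  injectiveDimension (ModuleCat.of.{u} Λ Λ) ≠ ⊤ ∧
    injectiveDimension (ModuleCat.of.{u} Λᵐᵒᵖ Λ) ≠ ⊤

section Modules

variable {Λ : Type u} [Ring Λ]

/-- A submodule `K` of `X` is superfluous if `N + K = X` forces `N = X`. -/
def IsSuperfluous {X : Type u} [AddCommGroup X] [Module Λ X] (K : Submodule Λ X) : Prop :=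
  ∀ N : Submodule Λ X, N ⊔ K = ⊤ → N = ⊤

/-- A projective cover of a finitely generated module: a surjection from a finitely generated
projective module with superfluous kernel. -/
structure ProjectiveCover (M : FGModuleCat.{u} Λ) where
  obj : FGModuleCat.{u} Λ
  π : obj →ₗ[Λ] M
  projective : Module.Projective Λ obj
  surjective : Function.Surjective π
  superfluous : IsSuperfluous (LinearMap.ker π)

/-- Over a left artinian ring, projective covers of finitely generated modules exist. -/
theorem nonempty_projectiveCover [IsArtinianRing Λ] (M : FGModuleCat.{u} Λ) :
    Nonempty (ProjectiveCover M) := by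
  classical
  obtain ⟨n, f, hf⟩ := Module.Finite.exists_fin' Λ M
  let S : Set (Submodule Λ (Fin n → Λ)) :=
    {N | Module.Projective Λ N ∧ Function.Surjective (f.domRestrict N)}
  have hS : S.Nonempty := by
    refine ⟨⊤, Module.Projective.of_equiv (Submodule.topEquiv).symm, fun m => ?_⟩
    obtain ⟨x, hx⟩ := hf m
    exact ⟨⟨x, trivial⟩, hx⟩
  obtain ⟨N, ⟨hNp, hNs⟩, hmin⟩ := IsArtinian.set_has_minimal S hS
  let π : N →ₗ[Λ] M := f.domRestrict N
  refine ⟨⟨FGModuleCat.of Λ N, π, hNp, hNs, fun L hL => ?_⟩⟩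
  -- lift `π` through its restriction to `L`
  have hLs : Function.Surjective (π.domRestrict L) := by
    intro m
    obtain ⟨x, hx⟩ := hNs m
    have hx' : x ∈ L ⊔ LinearMap.ker π := by rw [hL]; trivial
    obtain ⟨y, hy, z, hz, rfl⟩ := Submodule.mem_sup.1 hx'
    refine ⟨⟨y, hy⟩, ?_⟩
    have hz' : π z = 0 := hz
    have hx2 : π (y + z) = m := hx
    rw [map_add, hz', add_zero] at hx2
    exact hx2
  obtain ⟨g, hg⟩ := Module.projective_lifting_property (π.domRestrict L) π hLs
  let e : Module.End Λ N := L.subtype ∘ₗ g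
  have he : ∀ x, π (e x) = π x := fun x => LinearMap.congr_fun hg x
  have hek : ∀ (m : ℕ) x, π ((e ^ m) x) = π x := by
    intro m
    induction m with
    | zero => intro x; rfl
    | succ m ih => intro x; rw [pow_succ, Module.End.mul_apply, ih, he]
  obtain ⟨m, hm⟩ := Filter.eventually_atTop.1 e.eventually_isCompl_ker_pow_range_pow
  have hc := hm (m + 1) (by omega)
  -- the range of the iterate is a direct summand of `N`, hence projective
  have hproj : Module.Projective Λ (LinearMap.range (e ^ (m + 1))) :=
    Module.Projective.of_split (LinearMap.range (e ^ (m + 1))).subtype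
      (Submodule.projectionOnto _ _ hc.symm) (by ext x; simp)
  have hR : (LinearMap.range (e ^ (m + 1))).map N.subtype ∈ S := by
    refine ⟨Module.Projective.of_equiv
      (Submodule.equivMapOfInjective N.subtype N.injective_subtype _), fun y => ?_⟩
    obtain ⟨x, hx⟩ := hNs y
    refine ⟨⟨((e ^ (m + 1)) x : N), Submodule.mem_map_of_mem (LinearMap.mem_range_self _ x)⟩, ?_⟩
    exact (hek (m + 1) x).trans hx
  have hnot := hmin _ hR
  have hle : (LinearMap.range (e ^ (m + 1))).map N.subtype ≤ N := Submodule.map_subtype_le _ _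
  have heq : (LinearMap.range (e ^ (m + 1))).map N.subtype = N := by
    by_contra h
    exact hnot (lt_of_le_of_ne hle h)
  rw [eq_top_iff]
  intro x _
  have hx : (x : Fin n → Λ) ∈ (LinearMap.range (e ^ (m + 1))).map N.subtype := by
    rw [heq]; exact x.2
  obtain ⟨y, ⟨z, hz⟩, hy⟩ := hx
  have hyx : y = x := Subtype.ext hy
  rw [← hyx, ← hz, pow_succ', Module.End.mul_apply]
  exact (g _).2

end Modules

section Syzygies

variable (k : Type w) [Field k] {Λ : Type u} [Ring Λ] [Algebra k Λ] [Module.Finite k Λ]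

/-- A projective cover of a finitely generated module over a finite dimensional `k`-algebra
(the field only enters through the existence proof). -/
noncomputable def projectiveCover (M : FGModuleCat.{u} Λ) : ProjectiveCover M :=
  haveI : IsArtinianRing Λ := IsArtinianRing.of_finite k Λ
  (nonempty_projectiveCover M).some

/-- The syzygy `Ω(M)`: the kernel of a projective cover of `M`. -/
noncomputable def syzygy (M : FGModuleCat.{u} Λ) : FGModuleCat.{u} Λ :=
  haveI : IsArtinianRing Λ := IsArtinianRing.of_finite k Λ
  FGModuleCat.of Λ (LinearMap.ker (projectiveCover k M).π)

/-- The iterated syzygy `Ω^n(M)`, with `Ω^0(M) = M`. -/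
noncomputable def iteratedSyzygy (n : ℕ) (M : FGModuleCat.{u} Λ) : FGModuleCat.{u} Λ :=
  (syzygy k)^[n] M

/-- `M` is periodic of period `p`: `p` is the least positive integer with `Ω^p(M) ≅ M`. -/
def IsPeriodicOfPeriod (M : FGModuleCat.{u} Λ) (p : ℕ) : Prop :=
  IsLeast {q : ℕ | 0 < q ∧ Nonempty (iteratedSyzygy k q M ≅ M)} p

end Syzygies

section CompleteResolutions

variable {Λ : Type u} [Ring Λ]

/-- A projective resolution `P → M` of a finitely generated module by finitely generated projective
modules; the complex `P` is indexed by `ℤ` and vanishes in negative degrees. -/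
structure FGProjectiveResolution (M : FGModuleCat.{u} Λ) where
  complex : ChainComplex (ModuleCat.{u} Λ) ℤ
  finite : ∀ i, Module.Finite Λ (complex.X i)
  projective : ∀ i, Module.Projective Λ (complex.X i)
  isZero : ∀ i < 0, IsZero (complex.X i)
  /-- The augmentation. -/
  ε : complex.X 0 ⟶ M.obj
  surjective : Function.Surjective ε.hom
  exact_zero : Function.Exact (complex.d 1 0).hom ε.hom
  exact_pos : ∀ i, 0 < i → complex.ExactAt i

/-- The resolution is minimal: `P₀ → M` is a projective cover, and so is each `Pᵢ → im dᵢ`, `i > 0`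
(by exactness, the kernel of this map is the image of `dᵢ₊₁`). -/
def FGProjectiveResolution.IsMinimal {M : FGModuleCat.{u} Λ} (P : FGProjectiveResolution M) :
    Prop :=
  ∀ i : ℤ, 0 ≤ i → IsSuperfluous (LinearMap.range (P.complex.d (i + 1) i).hom)

/-- A complete resolution `T → P → M`: an acyclic complex `T` of finitely generated projective
modules, a projective resolution `P → M`, and a chain map `θ : T → P` which is an isomorphism in all
sufficiently large degrees. -/
structure CompleteResolution (M : FGModuleCat.{u} Λ) where
  T : ChainComplex (ModuleCat.{u} Λ) ℤ
  finite : ∀ i, Module.Finite Λ (T.X i)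
  projective : ∀ i, Module.Projective Λ (T.X i)
  acyclic : T.Acyclic
  P : FGProjectiveResolution M
  θ : T ⟶ P.complex
  eventually_isIso : ∃ N : ℤ, ∀ i, N ≤ i → IsIso (θ.f i)

/-- `Ω_i(X)`, the cokernel of `d_{i+1} : X_{i+1} ⟶ X_i`. -/
noncomputable def cokernelAt (X : ChainComplex (ModuleCat.{u} Λ) ℤ) (i : ℤ) : ModuleCat.{u} Λ :=
  cokernel (X.d (i + 1) i)

/-- The positive integers `p` with `Ω_i(T) ≅ Ω_{i+p}(T)` for all integers `i`. -/
def CompleteResolution.periods {M : FGModuleCat.{u} Λ} (C : CompleteResolution M) : Set ℕ :=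
  {p : ℕ | 0 < p ∧ ∀ i : ℤ, Nonempty (cokernelAt C.T i ≅ cokernelAt C.T (i + p))}

/-- The complete resolution is periodic. -/
def CompleteResolution.IsPeriodic {M : FGModuleCat.{u} Λ} (C : CompleteResolution M) : Prop :=
  C.periods.Nonempty

/-- The complete resolution is periodic of period `p`. -/
def CompleteResolution.IsPeriodicOfPeriod {M : FGModuleCat.{u} Λ} (C : CompleteResolution M)
    (p : ℕ) : Prop :=
  IsLeast C.periods p

end CompleteResolutions

end GorensteinAlgebra

/-! For a minimal resolution `P` of `M`, uniqueness of projective covers gives `Ω_i(P) ≅ Ω^i(M)` for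
`i ≥ 0`. An isomorphism `Ω^n(M) ≅ Ω^{n+p}(M)` propagates to all degrees at least `n`, so there
`Ω_i(P)` depends only on `i` modulo `p`. Hence the stretch of `P` in degrees `n, …, n+p-1` can be
repeated to the left, which gives an acyclic complex `T` equal to `P` in degrees at least `n`
(`IsSpliceable`, `periodicIndex`).

The Gorenstein hypothesis produces `θ`. Finitely generated projectives are retracts of finite powers
of `Λ`, so dimension shifting makes `Hom(T, Q)` acyclic for each such `Q`
(`IsGorenstein.isHomAcyclic`). The identity in high degrees then extends downwards one degree at a
time (`exists_chainMap_extending`).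

All claims about periods rest on transport: `Ω_i(T) ≅ Ω^i(M)` for large `i`, and a period seen at
any far-out place can be carried back to `n` (`le_of_syzygyEquiv`) or, inside a periodic `T`, to any
degree. -/

namespace GorensteinAlgebra

/-! ### Uniqueness of projective covers -/

section Covers

variable {Λ : Type u} [Ring Λ]

/-- Uniqueness of projective covers. -/
theorem exists_equiv_of_superfluous {C C' M M' : Type u} [AddCommGroup C] [Module Λ C]
    [AddCommGroup C'] [Module Λ C'] [AddCommGroup M] [Module Λ M] [AddCommGroup M'] [Module Λ M']
    [Module.Projective Λ C] [Module.Projective Λ C'] (π : C →ₗ[Λ] M) (π' : C' →ₗ[Λ] M')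
    (hπ : Function.Surjective π) (hπ' : Function.Surjective π')
    (hK : IsSuperfluous (LinearMap.ker π)) (hK' : IsSuperfluous (LinearMap.ker π'))
    (e : M ≃ₗ[Λ] M') : ∃ F : C ≃ₗ[Λ] C', ∀ x, π' (F x) = e (π x) := by
  obtain ⟨F, hF⟩ := Module.projective_lifting_property π' (e.toLinearMap ∘ₗ π) hπ'
  have hF' : ∀ x, π' (F x) = e (π x) := fun x => LinearMap.congr_fun hF x
  have hsurj : Function.Surjective F := by
    rw [← LinearMap.range_eq_top]
    refine hK' _ (eq_top_iff.2 fun y _ => ?_)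
    obtain ⟨x, hx⟩ := hπ (e.symm (π' y))
    refine Submodule.mem_sup.2 ⟨F x, ⟨x, rfl⟩, y - F x, ?_, by simp⟩
    simp [hF', hx]
  -- Injectivity of `F` follows once its section `s` is surjective; the same superfluity argument,
  -- now for `ker π`, shows this.
  obtain ⟨s, hs⟩ := Module.projective_lifting_property F LinearMap.id hsurj
  have hs' : ∀ y, F (s y) = y := fun y => LinearMap.congr_fun hs y
  have hsr : Function.Surjective s := by
    rw [← LinearMap.range_eq_top]
    refine hK _ (eq_top_iff.2 fun x _ => ?_)
    refine Submodule.mem_sup.2 ⟨s (F x), ⟨_, rfl⟩, x - s (F x), ?_, by simp⟩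
    apply e.injective
    simp [← hF', hs']
  refine ⟨LinearEquiv.ofBijective F ⟨fun x y hxy => ?_, hsurj⟩, hF'⟩
  obtain ⟨a, rfl⟩ := hsr x
  obtain ⟨b, rfl⟩ := hsr y
  rw [hs', hs'] at hxy
  rw [hxy]

theorem nonempty_ker_equiv_ker {C C' M M' : Type u} [AddCommGroup C] [Module Λ C]
    [AddCommGroup C'] [Module Λ C'] [AddCommGroup M] [Module Λ M] [AddCommGroup M'] [Module Λ M']
    [Module.Projective Λ C] [Module.Projective Λ C'] (π : C →ₗ[Λ] M) (π' : C' →ₗ[Λ] M')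
    (hπ : Function.Surjective π) (hπ' : Function.Surjective π')
    (hK : IsSuperfluous (LinearMap.ker π)) (hK' : IsSuperfluous (LinearMap.ker π'))
    (e : M ≃ₗ[Λ] M') : Nonempty (LinearMap.ker π ≃ₗ[Λ] LinearMap.ker π') := by
  obtain ⟨F, hF⟩ := exists_equiv_of_superfluous π π' hπ hπ' hK hK' e
  refine ⟨F.ofSubmodules _ _ ?_⟩
  ext y
  constructor
  · rintro ⟨x, hx, rfl⟩
    have hx' : π x = 0 := hx
    simp [hF, hx']
  · intro hy
    refine ⟨F.symm y, ?_, by simp⟩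
    have hy' : π' y = 0 := hy
    apply e.injective
    simp [← hF, hy']

theorem nonempty_iso_iff {A B : FGModuleCat.{u} Λ} :
    Nonempty (A ≅ B) ↔ Nonempty (A ≃ₗ[Λ] B) := by
  constructor
  · rintro ⟨f⟩
    exact ⟨((forget₂ (FGModuleCat.{u} Λ) (ModuleCat.{u} Λ)).mapIso f).toLinearEquiv⟩
  · rintro ⟨e⟩
    exact ⟨(forget₂ (FGModuleCat.{u} Λ) (ModuleCat.{u} Λ)).preimageIso e.toModuleIso⟩

end Covers

/-! ### Periodicity among the syzygies of a module -/

section Syzygies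

variable (k : Type w) [Field k] {Λ : Type u} [Ring Λ] [Algebra k Λ] [Module.Finite k Λ]

theorem nonempty_ker_equiv_syzygy {C M : Type u} [AddCommGroup C] [Module Λ C] [AddCommGroup M]
    [Module Λ M] [Module.Projective Λ C] (π : C →ₗ[Λ] M) (hπ : Function.Surjective π)
    (hK : IsSuperfluous (LinearMap.ker π)) (N : FGModuleCat.{u} Λ) (e : M ≃ₗ[Λ] N) :
    Nonempty (LinearMap.ker π ≃ₗ[Λ] syzygy k N) :=
  have := (projectiveCover k N).projective
  nonempty_ker_equiv_ker π (projectiveCover k N).π hπ (projectiveCover k N).surjective hK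
    (projectiveCover k N).superfluous e

theorem syzygy_equiv {M N : FGModuleCat.{u} Λ} (h : Nonempty (M ≃ₗ[Λ] N)) :
    Nonempty (syzygy k M ≃ₗ[Λ] syzygy k N) :=
  have := (projectiveCover k M).projective
  nonempty_ker_equiv_syzygy k (projectiveCover k M).π (projectiveCover k M).surjective
    (projectiveCover k M).superfluous N h.some

theorem iteratedSyzygy_succ (n : ℕ) (M : FGModuleCat.{u} Λ) :
    iteratedSyzygy k (n + 1) M = syzygy k (iteratedSyzygy k n M) :=
  Function.iterate_succ_apply' _ _ _

theorem iteratedSyzygy_add (m n : ℕ) (M : FGModuleCat.{u} Λ) :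
    iteratedSyzygy k (m + n) M = iteratedSyzygy k m (iteratedSyzygy k n M) :=
  Function.iterate_add_apply _ _ _ _

theorem iteratedSyzygy_equiv (n : ℕ) {M N : FGModuleCat.{u} Λ} (h : Nonempty (M ≃ₗ[Λ] N)) :
    Nonempty (iteratedSyzygy k n M ≃ₗ[Λ] iteratedSyzygy k n N) := by
  induction n with
  | zero => exact h
  | succ n ih => rw [iteratedSyzygy_succ, iteratedSyzygy_succ]; exact syzygy_equiv k ih

/-- The syzygies `Ω^a(M)` and `Ω^b(M)` are isomorphic. -/
def SyzygyEquiv (M : FGModuleCat.{u} Λ) (a b : ℕ) : Prop :=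
  Nonempty (iteratedSyzygy k a M ≃ₗ[Λ] iteratedSyzygy k b M)

namespace SyzygyEquiv

variable {k} {M : FGModuleCat.{u} Λ} {a b c : ℕ}

theorem refl (a : ℕ) : SyzygyEquiv k M a a := ⟨LinearEquiv.refl _ _⟩

theorem symm (h : SyzygyEquiv k M a b) : SyzygyEquiv k M b a := ⟨h.some.symm⟩

theorem trans (h : SyzygyEquiv k M a b) (h' : SyzygyEquiv k M b c) : SyzygyEquiv k M a c :=
  ⟨h.some.trans h'.some⟩

theorem add (h : SyzygyEquiv k M a b) (m : ℕ) : SyzygyEquiv k M (a + m) (b + m) := by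
  rw [SyzygyEquiv, add_comm a, add_comm b, iteratedSyzygy_add, iteratedSyzygy_add]
  exact iteratedSyzygy_equiv k m h

theorem shift (h : SyzygyEquiv k M a b) {c d : ℕ} (hc : a ≤ c) (hd : c + b = a + d) :
    SyzygyEquiv k M c d := by
  obtain ⟨m, rfl⟩ := Nat.exists_eq_add_of_le hc
  obtain rfl : d = b + m := by omega
  exact h.add m

theorem add_mul (h : SyzygyEquiv k M a (a + b)) (s : ℕ) : SyzygyEquiv k M a (a + s * b) := by
  induction s with
  | zero => simpa using refl a
  | succ s ih => exact ih.trans (h.shift (by omega) (by ring))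

theorem of_mod_eq (h : SyzygyEquiv k M a (a + b)) {c d : ℕ} (hc : a ≤ c) (hd : a ≤ d)
    (hcd : c ≡ d [MOD b]) : SyzygyEquiv k M c d := by
  wlog hle : c ≤ d generalizing c d
  · exact (this hd hc hcd.symm (by omega)).symm
  obtain ⟨s, hs⟩ := (Nat.modEq_iff_dvd' hle).1 hcd
  exact (h.add_mul s).shift hc (by rw [mul_comm s, ← hs]; omega)

end SyzygyEquiv

theorem isPeriodicOfPeriod_iteratedSyzygy {M : FGModuleCat.{u} Λ} {n p : ℕ} :
    IsPeriodicOfPeriod k (iteratedSyzygy k n M) p ↔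
      IsLeast {q : ℕ | 0 < q ∧ SyzygyEquiv k M n (n + q)} p := by
  have : ∀ q, Nonempty (iteratedSyzygy k q (iteratedSyzygy k n M) ≅ iteratedSyzygy k n M) ↔
      SyzygyEquiv k M n (n + q) := fun q => by
    rw [← iteratedSyzygy_add, nonempty_iso_iff, add_comm]
    exact ⟨SyzygyEquiv.symm, SyzygyEquiv.symm⟩
  simp only [IsPeriodicOfPeriod, this]

/-- The period of a periodic syzygy bounds every period occurring far out in the resolution. -/
theorem le_of_syzygyEquiv {M : FGModuleCat.{u} Λ} {n p : ℕ}
    (hp : IsLeast {q : ℕ | 0 < q ∧ SyzygyEquiv k M n (n + q)} p) {a q : ℕ} (hq : 0 < q)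
    (h : SyzygyEquiv k M a (a + q)) : p ≤ q := by
  refine hp.2 ⟨hq, ?_⟩
  -- Since `p ≥ 1`, moving `a` periods up from `n` passes `a`. There the step `q` is available, and
  -- moving back down gives `Ω^n ≅ Ω^{n+q}`.
  have hs : a ≤ n + a * p := by nlinarith [hp.1.1]
  have h1 := hp.1.2.add_mul a
  have h2 : SyzygyEquiv k M (n + a * p) (n + a * p + q) := h.shift hs (by ring)
  exact (h1.trans h2).trans (h1.shift (c := n + q) (by omega) (by ring)).symm

theorem period_unique {M : FGModuleCat.{u} Λ} {n p m q : ℕ}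
    (hp : IsPeriodicOfPeriod k (iteratedSyzygy k n M) p)
    (hq : IsPeriodicOfPeriod k (iteratedSyzygy k m M) q) : q = p := by
  rw [isPeriodicOfPeriod_iteratedSyzygy] at hp hq
  exact le_antisymm (le_of_syzygyEquiv k hq hp.1.1 hp.1.2) (le_of_syzygyEquiv k hp hq.1.1 hq.1.2)

end Syzygies

/-! ### Cokernels of differentials -/

section Complexes

variable {Λ : Type u} [Ring Λ]

theorem exactAt_succ_iff (K : ChainComplex (ModuleCat.{u} Λ) ℤ) (i : ℤ) :
    K.ExactAt (i + 1) ↔ Function.Exact (K.d (i + 1 + 1) (i + 1)).hom (K.d (i + 1) i).hom := by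
  rw [K.exactAt_iff' (i + 1 + 1) (i + 1) i (by simp) (by simp),
    ShortComplex.ShortExact.moduleCat_exact_iff_function_exact]
  rfl

/-- `Ω_i(X)` as a quotient module. -/
noncomputable def cokernelAtEquiv (X : ChainComplex (ModuleCat.{u} Λ) ℤ) (i : ℤ) :
    cokernelAt X i ≃ₗ[Λ] X.X i ⧸ LinearMap.range (X.d (i + 1) i).hom :=
  (ModuleCat.cokernelIsoRangeQuotient _).toLinearEquiv

theorem nonempty_cokernelAt_iso_iff {X Y : ChainComplex (ModuleCat.{u} Λ) ℤ} {i j : ℤ} :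
    Nonempty (cokernelAt X i ≅ cokernelAt Y j) ↔
      Nonempty (cokernelAt X i ≃ₗ[Λ] cokernelAt Y j) :=
  ⟨fun ⟨f⟩ => ⟨f.toLinearEquiv⟩, fun ⟨e⟩ => ⟨e.toModuleIso⟩⟩

/-- In an exact complex, the image of `dᵢ₊₁` is `Ω_{i+1}`. -/
noncomputable def rangeEquivCokernelAt (X : ChainComplex (ModuleCat.{u} Λ) ℤ) (i : ℤ)
    (h : X.ExactAt (i + 1)) :
    LinearMap.range (X.d (i + 1) i).hom ≃ₗ[Λ] cokernelAt X (i + 1) :=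
  (LinearMap.quotKerEquivRange _).symm.trans
    ((Submodule.quotEquivOfEq _ _ (((exactAt_succ_iff X i).1 h).linearMap_ker_eq)).trans
      (cokernelAtEquiv X (i + 1)).symm)

/-- A chain map which is invertible in degrees `i` and `i + 1` identifies the modules `Ω_i`. -/
theorem nonempty_cokernelAt_equiv {X Y : ChainComplex (ModuleCat.{u} Λ) ℤ} (θ : X ⟶ Y) (i : ℤ)
    [IsIso (θ.f i)] [IsIso (θ.f (i + 1))] :
    Nonempty (cokernelAt X i ≃ₗ[Λ] cokernelAt Y i) :=
  ⟨(cokernel.mapIso (X.d (i + 1) i) (Y.d (i + 1) i) (asIso (θ.f (i + 1))) (asIso (θ.f i))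
    (by simp)).toLinearEquiv⟩

end Complexes

/-! ### Periods of complete resolutions -/

section Resolutions

variable (k : Type w) [Field k] {Λ : Type u} [Ring Λ] [Algebra k Λ] [Module.Finite k Λ]

/-- Minimality makes `P_n → Ω_n(P)` a projective cover. Its kernel is the image of `d_{n+1}`, which
is `Ω_{n+1}(P)` by exactness, so induction applies. -/
theorem FGProjectiveResolution.IsMinimal.cokernelAt_equiv {M : FGModuleCat.{u} Λ}
    {P : FGProjectiveResolution M} (hP : P.IsMinimal) (n : ℕ) :
    Nonempty (cokernelAt P.complex n ≃ₗ[Λ] iteratedSyzygy k n M) := by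
  induction n with
  | zero =>
    exact ⟨(cokernelAtEquiv P.complex 0).trans ((Submodule.quotEquivOfEq _ _
      P.exact_zero.linearMap_ker_eq.symm).trans
        (P.ε.hom.quotKerEquivOfSurjective P.surjective))⟩
  | succ n ih =>
    obtain ⟨e⟩ := ih
    have := P.projective n
    have hker := Submodule.ker_mkQ (LinearMap.range (P.complex.d ((n : ℤ) + 1) n).hom)
    obtain ⟨f⟩ := nonempty_ker_equiv_syzygy k
      (LinearMap.range (P.complex.d ((n : ℤ) + 1) n).hom).mkQ (Submodule.mkQ_surjective _)
      (by rw [hker]; exact hP n (by positivity)) (iteratedSyzygy k n M)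
      ((cokernelAtEquiv P.complex n).symm.trans e)
    rw [iteratedSyzygy_succ]
    exact ⟨(rangeEquivCokernelAt P.complex n (P.exact_pos _ (by positivity))).symm.trans
      ((LinearEquiv.ofEq _ _ hker.symm).trans f)⟩

theorem CompleteResolution.eventually_cokernelAt_equiv {M : FGModuleCat.{u} Λ}
    (C : CompleteResolution M) (hC : C.P.IsMinimal) :
    ∃ N : ℕ, ∀ n : ℕ, N ≤ n → Nonempty (cokernelAt C.T n ≃ₗ[Λ] iteratedSyzygy k n M) := by
  obtain ⟨N, hN⟩ := C.eventually_isIso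
  refine ⟨N.toNat, fun n hn => ?_⟩
  have := hN n (by omega)
  have := hN (n + 1) (by omega)
  exact ⟨(nonempty_cokernelAt_equiv C.θ n).some.trans (hC.cokernelAt_equiv k n).some⟩

/-- Some period `q` of `T` moves any degree into the range where `T` agrees with `P`, and there `p`
is a period. Conversely each period of `T` is visible in that range, so `p` bounds it from below. -/
theorem isPeriodicOfPeriod_completeResolution {M : FGModuleCat.{u} Λ} {n p : ℕ}
    (hp : IsPeriodicOfPeriod k (iteratedSyzygy k n M) p)
    (C : CompleteResolution M) (hC : C.P.IsMinimal) (hper : C.IsPeriodic) :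
    C.IsPeriodicOfPeriod p := by
  rw [isPeriodicOfPeriod_iteratedSyzygy] at hp
  obtain ⟨N, hN⟩ := C.eventually_cokernelAt_equiv k hC
  constructor
  · refine ⟨hp.1.1, fun i => nonempty_cokernelAt_iso_iff.2 ?_⟩
    obtain ⟨q, hq, hqi⟩ := hper
    have hs : ∀ (s : ℕ) (i : ℤ), Nonempty (cokernelAt C.T i ≃ₗ[Λ] cokernelAt C.T (i + s * q)) := by
      intro s
      induction s with
      | zero =>
        intro i
        rw [show i + (0 : ℕ) * (q : ℤ) = i by simp]
        exact ⟨LinearEquiv.refl _ _⟩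
      | succ s ih =>
        intro i
        have h1 := nonempty_cokernelAt_iso_iff.1 (hqi (i + s * q))
        rw [show i + s * (q : ℤ) + q = i + (s + 1 : ℕ) * q by push_cast; ring] at h1
        exact ⟨(ih i).some.trans h1.some⟩
    -- move far to the left, where `T` agrees with the minimal resolution
    obtain ⟨s, hs0⟩ : ∃ s : ℕ, (N + n : ℤ) ≤ i + s * q := by
      refine ⟨(N + n - i).toNat, ?_⟩
      have h1 : (N + n - i : ℤ) ≤ (N + n - i).toNat := Int.self_le_toNat _
      have h2 : (1 : ℤ) ≤ q := by exact_mod_cast hq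
      nlinarith [Int.natCast_nonneg (N + n - i : ℤ).toNat]
    obtain ⟨j, hj⟩ := Int.eq_ofNat_of_zero_le (a := i + s * q) (by omega)
    obtain ⟨e⟩ := hs s i
    obtain ⟨f⟩ := hs s (i + p)
    rw [show i + p + s * (q : ℤ) = (j + p : ℕ) by push_cast; linarith] at f
    rw [hj] at e
    obtain ⟨g⟩ := hp.1.2.shift (c := j) (d := j + p) (by omega) (by ring)
    exact ⟨e.trans ((hN j (by omega)).some.trans (g.trans
      ((hN (j + p) (by omega)).some.symm.trans f.symm)))⟩
  · rintro q ⟨hq, hqi⟩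
    obtain ⟨e⟩ := nonempty_cokernelAt_iso_iff.1 (hqi N)
    obtain ⟨f⟩ := hN N le_rfl
    obtain ⟨g⟩ := hN (N + q) (by omega)
    rw [Nat.cast_add] at g
    exact le_of_syzygyEquiv k hp (a := N) hq ⟨f.symm.trans (e.trans g)⟩

end Resolutions

/-! ### Acyclicity of `Hom(T, Q)` -/

section Extension

variable {Λ : Type u} [Ring Λ]

/-- Every map from a complex `T` to `Q` in a single degree which is a cocycle of `Hom(T, Q)` is a
coboundary. -/
def IsHomAcyclic (T : ChainComplex (ModuleCat.{u} Λ) ℤ) (Q : ModuleCat.{u} Λ) : Prop :=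
  ∀ (i : ℤ) (f : T.X (i + 1) ⟶ Q), T.d (i + 1 + 1) (i + 1) ≫ f = 0 →
    ∃ g : T.X i ⟶ Q, T.d (i + 1) i ≫ g = f

theorem IsHomAcyclic.of_injective {T : ChainComplex (ModuleCat.{u} Λ) ℤ} (hT : T.Acyclic)
    (Q : ModuleCat.{u} Λ) [Injective Q] : IsHomAcyclic T Q := by
  intro i f hf
  have h := hT (i + 1)
  rw [T.exactAt_iff' (i + 1 + 1) (i + 1) i (by simp) (by simp)] at h
  exact ⟨h.descToInjective f hf, h.comp_descToInjective f hf⟩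

/-- Dimension shifting: `f` becomes the coboundary of some `g` into `X₂`. The image of `g` in `X₃`
is a cocycle, hence a coboundary from one degree lower, which lifts to `X₂` by projectivity.
Correcting `g` by that lift makes it land in `X₁`. -/
theorem IsHomAcyclic.of_shortExact {T : ChainComplex (ModuleCat.{u} Λ) ℤ}
    (hproj : ∀ i, Module.Projective Λ (T.X i)) {S : ShortComplex (ModuleCat.{u} Λ)}
    (hS : S.ShortExact) (h₂ : IsHomAcyclic T S.X₂) (h₃ : IsHomAcyclic T S.X₃) :
    IsHomAcyclic T S.X₁ := by
  intro i f hf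
  obtain ⟨j, rfl⟩ : ∃ j, i = j + 1 := ⟨i - 1, by ring⟩
  have := hS.mono_f
  have := hS.epi_g
  have := (IsProjective.iff_projective (T.X j)).1 (hproj j)
  obtain ⟨g, hg⟩ := h₂ (j + 1) (f ≫ S.f) (by rw [reassoc_of% hf, zero_comp])
  obtain ⟨r, hr⟩ := h₃ j (g ≫ S.g) (by
    rw [reassoc_of% hg, S.zero, comp_zero])
  let r' := Projective.factorThru r S.g
  have hr' : r' ≫ S.g = r := Projective.factorThru_comp _ _
  have hz : (g - T.d (j + 1) j ≫ r') ≫ S.g = 0 := by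
    rw [Preadditive.sub_comp, Category.assoc, hr', hr, sub_self]
  refine ⟨hS.exact.lift _ hz, ?_⟩
  rw [← cancel_mono S.f, Category.assoc, hS.exact.lift_f, Preadditive.comp_sub, hg,
    T.d_comp_d_assoc, zero_comp, sub_zero]

/-- The bound `n + 1` is strict, so `n = 0` is the injective case; embedding `Q` in an injective
lowers the dimension of the cokernel. -/
theorem IsHomAcyclic.of_hasInjectiveDimensionLT {T : ChainComplex (ModuleCat.{u} Λ) ℤ}
    (hT : T.Acyclic) (hproj : ∀ i, Module.Projective Λ (T.X i)) (n : ℕ) (Q : ModuleCat.{u} Λ)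
    [HasInjectiveDimensionLT Q (n + 1)] : IsHomAcyclic T Q := by
  induction n generalizing Q with
  | zero =>
    have : Injective Q := (injective_iff_hasInjectiveDimensionLT_one).2 ‹_›
    exact .of_injective hT Q
  | succ n ih =>
    let S : ShortComplex (ModuleCat.{u} Λ) :=
      ShortComplex.mk (Injective.ι Q) (cokernel.π (Injective.ι Q)) (by simp)
    have hS : S.ShortExact :=
      { exact := ShortComplex.exact_of_g_is_cokernel _ (cokernelIsCokernel _)
        mono_f := by dsimp [S]; infer_instance
        epi_g := by dsimp [S]; infer_instance }
    have hinj : Injective S.X₂ := by dsimp [S]; infer_instance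
    have := (hS.hasInjectiveDimensionLT_X₃_iff n hinj).2 ‹_›
    exact of_shortExact hproj hS (.of_injective hT _) (ih S.X₃)

theorem IsHomAcyclic.of_retract {T : ChainComplex (ModuleCat.{u} Λ) ℤ} {Q R : ModuleCat.{u} Λ}
    (hQ : IsHomAcyclic T Q) (r : Retract R Q) : IsHomAcyclic T R := by
  intro i f hf
  obtain ⟨g, hg⟩ := hQ i (f ≫ r.i) (by rw [reassoc_of% hf, zero_comp])
  exact ⟨g ≫ r.r, by rw [reassoc_of% hg, r.retract, Category.comp_id]⟩

theorem IsHomAcyclic.pi {T : ChainComplex (ModuleCat.{u} Λ) ℤ} {ι : Type u} {Q : ι → Type u}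
    [∀ j, AddCommGroup (Q j)] [∀ j, Module Λ (Q j)]
    (h : ∀ j, IsHomAcyclic T (ModuleCat.of Λ (Q j))) :
    IsHomAcyclic T (ModuleCat.of Λ (∀ j, Q j)) := by
  intro i f hf
  choose g hg using fun j => h j i (f ≫ ModuleCat.ofHom (LinearMap.proj j))
    (by rw [reassoc_of% hf, zero_comp])
  refine ⟨ModuleCat.ofHom (LinearMap.pi fun j => (g j).hom), ?_⟩
  ext x j
  exact LinearMap.congr_fun (congrArg ModuleCat.Hom.hom (hg j)) x

/-- If `Λ` has finite injective dimension, then `Hom(T, Q)` is acyclic for every acyclic complex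
`T` of projectives and every finitely generated projective module `Q`. -/
theorem IsGorenstein.isHomAcyclic (hΛ : IsGorenstein Λ) {T : ChainComplex (ModuleCat.{u} Λ) ℤ}
    (hT : T.Acyclic) (hproj : ∀ i, Module.Projective Λ (T.X i)) (Q : ModuleCat.{u} Λ)
    [Module.Finite Λ Q] [Module.Projective Λ Q] : IsHomAcyclic T Q := by
  obtain ⟨d, hd⟩ := (injectiveDimension_ne_top_iff _).1 hΛ.1
  have hfree : IsHomAcyclic T (ModuleCat.of.{u} Λ Λ) :=
    have : HasInjectiveDimensionLT (ModuleCat.of.{u} Λ Λ) (d + 1) := hd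
    .of_hasInjectiveDimensionLT hT hproj d _
  obtain ⟨n, f, hf⟩ := Module.Finite.exists_fin' Λ Q
  let f' : (ULift.{u} (Fin n) → Λ) →ₗ[Λ] Q :=
    f ∘ₗ (LinearMap.funLeft Λ Λ ULift.up)
  have hf' : Function.Surjective f' :=
    hf.comp (LinearMap.funLeft_surjective_of_injective _ _ _ ULift.up_injective)
  obtain ⟨s, hs⟩ := Module.projective_lifting_property f' LinearMap.id hf'
  refine (IsHomAcyclic.pi (ι := ULift.{u} (Fin n)) fun _ => hfree).of_retract
    { i := ModuleCat.ofHom s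
      r := ModuleCat.ofHom f'
      retract := ?_ }
  ext x
  exact LinearMap.congr_fun hs x

end Extension

/-! ### Construction of the minimal resolution -/

section MinimalResolution

variable (k : Type w) [Field k] {Λ : Type u} [Ring Λ] [Algebra k Λ] [Module.Finite k Λ]
  (M : FGModuleCat.{u} Λ)

/-- The iterated syzygies of `M`, by recursion on the exponent. -/
noncomputable def syzygyTower : ℕ → FGModuleCat.{u} Λ
  | 0 => M
  | n + 1 => syzygy k (syzygyTower n)

/-- The projective cover of the `n`-th syzygy of `M`. -/
noncomputable def coverTower (n : ℕ) : ProjectiveCover (syzygyTower k M n) :=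
  projectiveCover k (syzygyTower k M n)

/-- The map between consecutive terms of the minimal projective resolution. -/
noncomputable def towerMap (n : ℕ) :
    (coverTower k M (n + 1)).obj →ₗ[Λ] (coverTower k M n).obj :=
  (LinearMap.ker (coverTower k M n).π).subtype ∘ₗ (coverTower k M (n + 1)).π

theorem range_towerMap (n : ℕ) :
    LinearMap.range (towerMap k M n) = LinearMap.ker (coverTower k M n).π := by
  refine (LinearMap.range_comp_of_range_eq_top _
    (LinearMap.range_eq_top.2 (coverTower k M (n + 1)).surjective)).trans ?_
  exact Submodule.range_subtype _

theorem ker_towerMap (n : ℕ) :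
    LinearMap.ker (towerMap k M n) = LinearMap.ker (coverTower k M (n + 1)).π :=
  LinearMap.ker_comp_of_ker_eq_bot _ (Submodule.ker_subtype _)

theorem exact_towerMap (n : ℕ) :
    Function.Exact (towerMap k M (n + 1)) (towerMap k M n) := by
  rw [LinearMap.exact_iff, ker_towerMap, range_towerMap]

/-- The terms of the minimal projective resolution of `M`. -/
noncomputable def minimalResolutionX : ℤ → ModuleCat.{u} Λ
  | Int.ofNat n => (coverTower k M n).obj.obj
  | Int.negSucc _ => ModuleCat.of Λ PUnit.{u + 1}

/-- The differentials of the minimal projective resolution of `M`. -/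
noncomputable def minimalResolutionD :
    ∀ i : ℤ, minimalResolutionX k M (i + 1) ⟶ minimalResolutionX k M i
  | Int.ofNat n => ModuleCat.ofHom (towerMap k M n)
  | Int.negSucc _ => 0

/-- The complex underlying the minimal projective resolution of `M`. -/
noncomputable def minimalResolutionComplex : ChainComplex (ModuleCat.{u} Λ) ℤ :=
  ChainComplex.of (minimalResolutionX k M) (minimalResolutionD k M) fun i => by
    rcases i with n | n
    · ext x
      exact (exact_towerMap k M n).apply_apply_eq_zero x
    · exact comp_zero

theorem minimalResolutionComplex_d (n : ℕ) :
    ((minimalResolutionComplex k M).d ((n : ℤ) + 1) n).hom = towerMap k M n :=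
  congrArg ModuleCat.Hom.hom
    (ChainComplex.of_d (minimalResolutionX k M) (minimalResolutionD k M) (n : ℤ))

/-- The minimal projective resolution of `M`. -/
noncomputable def minimalResolution : FGProjectiveResolution M where
  complex := minimalResolutionComplex k M
  finite i := by
    rcases i with n | n
    · exact (coverTower k M n).obj.property
    · exact inferInstanceAs (Module.Finite Λ PUnit.{u + 1})
  projective i := by
    rcases i with n | n
    · exact (coverTower k M n).projective
    · exact inferInstanceAs (Module.Projective Λ PUnit.{u + 1})
  isZero i hi := by
    rcases i with n | n
    · exact absurd hi (not_lt.2 (Int.natCast_nonneg n))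
    · exact ModuleCat.isZero_of_subsingleton (ModuleCat.of Λ PUnit.{u + 1})
  ε := ModuleCat.ofHom (coverTower k M 0).π
  surjective := (coverTower k M 0).surjective
  exact_zero := by
    have h := minimalResolutionComplex_d k M 0
    rw [LinearMap.exact_iff]
    exact (range_towerMap k M 0).symm.trans (congrArg LinearMap.range h.symm)
  exact_pos i hi := by
    obtain ⟨n, rfl⟩ : ∃ n : ℕ, i = (n : ℤ) + 1 := ⟨(i - 1).toNat, by omega⟩
    have h := minimalResolutionComplex_d k M n
    have h' := minimalResolutionComplex_d k M (n + 1)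
    rw [exactAt_succ_iff, LinearMap.exact_iff, h]
    exact ((exact_towerMap k M n).linearMap_ker_eq).trans (congrArg LinearMap.range h'.symm)

theorem minimalResolution_isMinimal : (minimalResolution k M).IsMinimal := by
  intro i hi
  obtain ⟨n, rfl⟩ := Int.eq_ofNat_of_zero_le hi
  have h := (congrArg LinearMap.range (minimalResolutionComplex_d k M n)).trans
    (range_towerMap k M n)
  exact h.symm ▸ (coverTower k M n).superfluous

end MinimalResolution

/-! ### Splicing complexes and extending chain maps -/

section Splicing

variable {Λ : Type u} [Ring Λ] {P : ChainComplex (ModuleCat.{u} Λ) ℤ}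

/-- An isomorphism `Ω_a(P) ≅ Ω_{b+1}(P)` allows to splice the part of `P` in degrees at least `a`
to the part in degrees at most `b`. -/
theorem exists_splicing_map {a b : ℤ} (hb : P.ExactAt (b + 1))
    (h : Nonempty (cokernelAt P a ≃ₗ[Λ] cokernelAt P (b + 1))) :
    ∃ d : P.X a ⟶ P.X b, LinearMap.ker d.hom = LinearMap.range (P.d (a + 1) a).hom ∧
      LinearMap.range d.hom = LinearMap.range (P.d (b + 1) b).hom ∧
      (a = b + 1 → d = P.d a b) := by
  -- Where nothing is spliced the original differential is kept, so that the comparison with `P`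
  -- commutes on the nose there.
  by_cases hab : a = b + 1
  · subst hab
    exact ⟨P.d _ _, ((exactAt_succ_iff P b).1 hb).linearMap_ker_eq, rfl, fun _ => rfl⟩
  · obtain ⟨e⟩ := h
    let e' : (P.X a ⧸ LinearMap.range (P.d (a + 1) a).hom) ≃ₗ[Λ]
        LinearMap.range (P.d (b + 1) b).hom :=
      (cokernelAtEquiv P a).symm.trans (e.trans (rangeEquivCokernelAt P b hb).symm)
    refine ⟨ModuleCat.ofHom ((LinearMap.range (P.d (b + 1) b).hom).subtype ∘ₗ
      (e'.toLinearMap ∘ₗ (LinearMap.range (P.d (a + 1) a).hom).mkQ)), ?_, ?_, fun h => absurd h hab⟩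
    · rw [ModuleCat.hom_ofHom, LinearMap.ker_comp_of_ker_eq_bot _ (Submodule.ker_subtype _),
        LinearMap.ker_comp_of_ker_eq_bot _ e'.ker, Submodule.ker_mkQ]
    · rw [ModuleCat.hom_ofHom, LinearMap.range_comp_of_range_eq_top, Submodule.range_subtype]
      rw [LinearMap.range_comp_of_range_eq_top _ (Submodule.range_mkQ _)]
      exact e'.range

/-- The reindexing `κ` of degrees can be realised by splicing the complex `P`. -/
structure IsSpliceable (P : ChainComplex (ModuleCat.{u} Λ) ℤ) (κ : ℤ → ℤ) : Prop where
  exactAt : ∀ i, P.ExactAt (κ i + 1)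
  equiv : ∀ i, Nonempty (cokernelAt P (κ (i + 1)) ≃ₗ[Λ] cokernelAt P (κ i + 1))

namespace IsSpliceable

variable {κ : ℤ → ℤ} (h : IsSpliceable P κ)

/-- The differentials of the spliced complex. -/
noncomputable def d (i : ℤ) : P.X (κ (i + 1)) ⟶ P.X (κ i) :=
  (exists_splicing_map (h.exactAt i) (h.equiv i)).choose

theorem ker_d (i : ℤ) :
    LinearMap.ker (h.d i).hom = LinearMap.range (P.d (κ (i + 1) + 1) (κ (i + 1))).hom :=
  (exists_splicing_map (h.exactAt i) (h.equiv i)).choose_spec.1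

theorem range_d (i : ℤ) :
    LinearMap.range (h.d i).hom = LinearMap.range (P.d (κ i + 1) (κ i)).hom :=
  (exists_splicing_map (h.exactAt i) (h.equiv i)).choose_spec.2.1

theorem d_eq (i : ℤ) (hi : κ (i + 1) = κ i + 1) : h.d i = P.d (κ (i + 1)) (κ i) :=
  (exists_splicing_map (h.exactAt i) (h.equiv i)).choose_spec.2.2 hi

theorem exact_d (i : ℤ) : Function.Exact (h.d (i + 1)).hom (h.d i).hom := by
  rw [LinearMap.exact_iff, ker_d, range_d]

/-- The complex with terms `P_{κ i}` obtained by splicing. -/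
noncomputable def complex : ChainComplex (ModuleCat.{u} Λ) ℤ :=
  ChainComplex.of (fun i => P.X (κ i)) h.d fun i => by
    ext x
    exact (h.exact_d i).apply_apply_eq_zero x

theorem complex_d (i : ℤ) : h.complex.d (i + 1) i = h.d i :=
  ChainComplex.of_d (fun i => P.X (κ i)) h.d i

theorem acyclic : h.complex.Acyclic := fun j => by
  obtain ⟨i, rfl⟩ : ∃ i, j = i + 1 := ⟨j - 1, by ring⟩
  rw [exactAt_succ_iff, complex_d, complex_d]
  exact h.exact_d i

theorem nonempty_cokernelAt_equiv (i : ℤ) :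
    Nonempty (cokernelAt h.complex i ≃ₗ[Λ] cokernelAt P (κ i)) := by
  refine ⟨(cokernelAtEquiv h.complex i).trans ((Submodule.quotEquivOfEq _ _ ?_).trans
    (cokernelAtEquiv P (κ i)).symm)⟩
  rw [complex_d]
  exact h.range_d i

end IsSpliceable

/-- A chain map given in degrees at least `n` extends to all degrees if the complexes
`Hom(T, Pᵢ)` are acyclic and `P` is bounded below. -/
theorem exists_chainMap_extending {T P : ChainComplex (ModuleCat.{u} Λ) ℤ}
    (hP : ∀ i < 0, IsZero (P.X i)) (hTP : ∀ i, IsHomAcyclic T (P.X i)) (n : ℤ)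
    (φ : ∀ i, T.X i ⟶ P.X i)
    (hφ : ∀ i, n ≤ i → T.d (i + 1) i ≫ φ i = φ (i + 1) ≫ P.d (i + 1) i) :
    ∃ θ : T ⟶ P, ∀ i, n ≤ i → θ.f i = φ i := by
  have key : ∀ j : ℕ, ∃ ψ : ∀ i, T.X i ⟶ P.X i, (∀ i, n ≤ i → ψ i = φ i) ∧
      ∀ i, n - j ≤ i → T.d (i + 1) i ≫ ψ i = ψ (i + 1) ≫ P.d (i + 1) i := by
    intro j
    induction j with
    | zero => exact ⟨φ, fun _ _ => rfl, fun i hi => hφ i (by simpa using hi)⟩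
    | succ j ih =>
      obtain ⟨ψ, hψ, hc⟩ := ih
      obtain ⟨m, hm⟩ : ∃ m, m + 1 = n - j := ⟨n - j - 1, by ring⟩
      -- The square in degree `m + 1` makes this composite a cocycle, and `g` is the missing
      -- component in degree `m`.
      obtain ⟨g, hg⟩ := hTP m m (ψ (m + 1) ≫ P.d (m + 1) m) (by
        rw [← Category.assoc, hc (m + 1) hm.ge, Category.assoc, P.d_comp_d, comp_zero])
      refine ⟨Function.update ψ m g, fun i hi => ?_, fun i hi => ?_⟩
      · rw [Function.update_of_ne (by omega), hψ i hi]
      · have h1 : i + 1 ≠ m := by push_cast at hi; omega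
        rw [Function.update_of_ne h1]
        rcases eq_or_ne i m with rfl | him
        · rw [Function.update_self, hg]
        · rw [Function.update_of_ne him, hc i (by push_cast at hi; omega)]
  -- This many steps reach all degrees at least `0`; in negative degrees the target of the square is
  -- zero.
  obtain ⟨ψ, hψ, hc⟩ := key (n.toNat + 1)
  refine ⟨{ f := ψ, comm' := ?_ }, hψ⟩
  rintro _ i rfl
  by_cases hi : 0 ≤ i
  · exact (hc i (by push_cast; omega)).symm
  · exact (hP i (by omega)).eq_of_tgt _ _

end Splicing

/-! ### Periodic reindexing of degrees -/

section PeriodicIndex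

/-- The identity in degrees at least `n`, continued to the left periodically with period `p`. -/
def periodicIndex (n p : ℕ) (i : ℤ) : ℤ :=
  if (n : ℤ) ≤ i then i else n + (i - n) % p

variable {n p : ℕ}

theorem periodicIndex_of_le {i : ℤ} (hi : (n : ℤ) ≤ i) : periodicIndex n p i = i := if_pos hi

theorem le_periodicIndex (hp : 0 < p) (i : ℤ) : (n : ℤ) ≤ periodicIndex n p i := by
  unfold periodicIndex
  split_ifs with h
  · exact h
  · have := Int.emod_nonneg (i - n) (b := (p : ℤ)) (by omega)
    omega

theorem periodicIndex_modEq (i : ℤ) : periodicIndex n p i ≡ i [ZMOD p] := by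
  unfold periodicIndex
  split_ifs with h
  · exact .refl _
  · simpa using (Int.mod_modEq (i - n) p).add_left n

end PeriodicIndex

/-! ### Existence of a periodic complete resolution -/

section Existence

variable (k : Type w) [Field k] {Λ : Type u} [Ring Λ] [Algebra k Λ] [Module.Finite k Λ]

theorem FGProjectiveResolution.IsMinimal.cokernelAt_equiv_of_modEq {M : FGModuleCat.{u} Λ}
    {P : FGProjectiveResolution M} (hP : P.IsMinimal) {n p : ℕ} (h : SyzygyEquiv k M n (n + p))
    {a b : ℤ} (ha : n ≤ a) (hb : n ≤ b) (hab : a ≡ b [ZMOD p]) :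
    Nonempty (cokernelAt P.complex a ≃ₗ[Λ] cokernelAt P.complex b) := by
  lift a to ℕ using by omega
  lift b to ℕ using by omega
  obtain ⟨e⟩ := hP.cokernelAt_equiv k a
  obtain ⟨f⟩ := hP.cokernelAt_equiv k b
  obtain ⟨g⟩ := h.of_mod_eq (c := a) (d := b) (by omega) (by omega) (Int.natCast_modEq_iff.1 hab)
  exact ⟨e.trans (g.trans f.symm)⟩

theorem exists_periodic_completeResolution (hΛ : IsGorenstein Λ) {M : FGModuleCat.{u} Λ} {n p : ℕ}
    (hp : 0 < p) (h : SyzygyEquiv k M n (n + p)) :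
    ∃ C : CompleteResolution M, C.P.IsMinimal ∧ C.IsPeriodic := by
  have hmin := minimalResolution_isMinimal k M
  let P := minimalResolution k M
  let κ := periodicIndex n p
  have hκ : ∀ i, (n : ℤ) ≤ κ i := le_periodicIndex hp
  -- Splicing needs only `κ (i + 1) ≡ κ i + 1` modulo `p`, with both sides at least `n`.
  have hs : IsSpliceable P.complex κ :=
    { exactAt := fun i => P.exact_pos _ (by have := hκ i; omega)
      equiv := fun i => hmin.cokernelAt_equiv_of_modEq k h (hκ _) (by have := hκ i; omega)
        ((periodicIndex_modEq _).trans ((periodicIndex_modEq i).symm.add_right 1)) }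
  have hproj : ∀ i, Module.Projective Λ (hs.complex.X i) := fun i => P.projective (κ i)
  have hacyc : ∀ i, IsHomAcyclic hs.complex (P.complex.X i) := fun i =>
    have := P.projective i
    have := P.finite i
    hΛ.isHomAcyclic hs.acyclic hproj _
  classical
  let φ : ∀ i, hs.complex.X i ⟶ P.complex.X i := fun i =>
    if hi : κ i = i then (P.complex.XIsoOfEq hi).hom else 0
  have hφ : ∀ i (hi : (n : ℤ) ≤ i),
      φ i = (P.complex.XIsoOfEq (periodicIndex_of_le (p := p) hi)).hom := fun i hi =>
    dif_pos (periodicIndex_of_le hi)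
  obtain ⟨θ, hθ⟩ := exists_chainMap_extending P.isZero hacyc n φ (fun i hi => by
    have h1 : κ (i + 1) = κ i + 1 :=
      (periodicIndex_of_le (by omega)).trans (congrArg (· + 1) (periodicIndex_of_le hi).symm)
    rw [hφ i hi, hφ (i + 1) (by omega), hs.complex_d, hs.d_eq i h1]
    exact (P.complex.d_comp_XIsoOfEq_hom _ _).trans (P.complex.XIsoOfEq_hom_comp_d _ _).symm)
  refine ⟨{ T := hs.complex
            finite := fun i => P.finite (κ i)
            projective := hproj
            acyclic := hs.acyclic
            P := P
            θ := θ
            eventually_isIso := ⟨n, fun i hi => ?_⟩ }, hmin, p, hp, fun i => ?_⟩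
  · rw [hθ i hi, hφ i hi]
    exact Iso.isIso_hom _
  · refine nonempty_cokernelAt_iso_iff.2 ?_
    obtain ⟨e⟩ := hs.nonempty_cokernelAt_equiv i
    obtain ⟨f⟩ := hs.nonempty_cokernelAt_equiv (i + p)
    have hmod : κ i ≡ κ (i + p) [ZMOD p] :=
      ((periodicIndex_modEq i).trans (by simp [Int.ModEq])).trans (periodicIndex_modEq (i + p)).symm
    obtain ⟨g⟩ := hmin.cokernelAt_equiv_of_modEq k h (hκ i) (hκ (i + p)) hmod
    exact ⟨e.trans (g.trans f.symm)⟩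

end Existence

end GorensteinAlgebra

theorem proposition3p2 (k : Type w) [Field k] [IsAlgClosed k]
    (Λ : Type u) [Ring Λ] [Algebra k Λ] [Module.Finite k Λ]
    (hΛ : GorensteinAlgebra.IsGorenstein Λ) (M : FGModuleCat.{u} Λ) (n p : ℕ)
    (hM : GorensteinAlgebra.IsPeriodicOfPeriod k (GorensteinAlgebra.iteratedSyzygy k n M) p) :
    -- a periodic complete resolution of period `p`, over a minimal projective resolution
    (∃ C : GorensteinAlgebra.CompleteResolution M, C.P.IsMinimal ∧ C.IsPeriodicOfPeriod p) ∧
    -- every choice of periodic syzygy has the same period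
    (∀ m q : ℕ, GorensteinAlgebra.IsPeriodicOfPeriod k
      (GorensteinAlgebra.iteratedSyzygy k m M) q → q = p) ∧
    -- every periodic complete resolution over a minimal projective resolution has period `p`
    (∀ C : GorensteinAlgebra.CompleteResolution M,
      C.P.IsMinimal → C.IsPeriodic → C.IsPeriodicOfPeriod p) := by
  obtain ⟨hp, hn⟩ := ((GorensteinAlgebra.isPeriodicOfPeriod_iteratedSyzygy k).1 hM).1
  refine ⟨?_, fun m q hq => GorensteinAlgebra.period_unique k hM hq, fun C hC hper =>
    GorensteinAlgebra.isPeriodicOfPeriod_completeResolution k hM C hC hper⟩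
  obtain ⟨C, hC, hper⟩ := GorensteinAlgebra.exists_periodic_completeResolution k hΛ hp hn
  exact ⟨C, hC, GorensteinAlgebra.isPeriodicOfPeriod_completeResolution k hM C hC hper⟩
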